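/- Let $n\ge 1$ and $\alpha\in(0,1)$. For $\phi,\psi:\mathbb{R}^n\to\mathbb{R}$ put, whenever the integrals converge absolutely, $$\nabla^\alpha\phi(x)=\mu_{n,\alpha}\int_{\mathbb{R}^n}\frac{\phi(y)-\phi(x)}{|y-x|^{n+\alpha}}\frac{y-x}{|y-x|}\,dy,\qquad \nabla^\alpha_{\mathrm{NL}}(\phi,\psi)(x)=\mu_{n,\alpha}\int_{\mathbb{R}^n}\frac{(y-x)(\phi(y)-\phi(x))(\psi(y)-\psi(x))}{|y-x|^{n+\alpha+1}}\,dy,$$ with $\mu_{n,\alpha}=2^{\alpha}\pi^{-n/2}\,\Gamma\big(\tfrac{n+\alpha+1}{2}\big)/\Gamma\big(\tfrac{1-\alpha}{2}\big)$. For $u\in L^1(\mathbb{R}^n)+L^\infty(\mathbb{R}^n)$, a function $v\in L^1_{\mathrm{loc}}(\mathbb{R}^n;\mathbb{R}^n)$ is called the weak $\alpha$-fractional gradient of $u$, written $v=\nabla^\alpha u$, if $\int_{\mathbb{R}^n} v\,\phi\,dx=-\int_{\mathbb{R}^n}u\,\nabla^\alpha\phi\,dx$ for all $\phi\in C_c^\infty(\mathbb{R}^n)$.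 For $p\in[1,\infty]$ let $S^{\alpha,p}(\mathbb{R}^n)$ be the space of all real-valued $u\in L^p(\mathbb{R}^n)$ that have a weak $\alpha$-fractional gradient in $L^p(\mathbb{R}^n;\mathbb{R}^n)$. There is a constant $C=C(n,\alpha)>0$ such that for all $p\in[1,\infty]$, all bounded Lipschitz functions $\psi:\mathbb{R}^n\to\mathbb{R}$ with smallest Lipschitz constant $\mathrm{Lip}(\psi)$, and all $u\in S^{\alpha,p}(\mathbb{R}^n)$ the following holds. The product $\psi u$ lies in $S^{\alpha,p}(\mathbb{R}^n)$; the integral defining $\nabla^\alpha\psi(x)$ converges absolutely for every $x$, the one defining $\nabla^\alpha_{\mathrm{NL}}(u,\psi)(x)$ for almost every $x$; and the weak $\alpha$-fractional gradients of $u$ and $\psi u$ satisfy $$\nabla^\alpha(\psi u)=\psi\,\nabla^\alpha u+u\,\nabla^\alpha\psi+\nabla^\alpha_{\mathrm{NL}}(u,\psi)\qquad\text{a.e. in }\mathbb{R}^n,$$ $$\|\nabla^\alpha(\psi u)-\psi\,\nabla^\alpha u\|_p\le C\,\|\psi\|_\infty^{1-\alpha}\,\mathrm{Lip}(\psi)^\alpha\,\|u\|_p.$$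 -/

import Mathlib

open MeasureTheory
open scoped NNReal ENNReal ContDiff

noncomputable section

namespace RieszFrac

/-- `Lip_b(ℝⁿ)`: bounded, Lipschitz continuous real-valued functions on `ℝⁿ`. -/
def IsLipB {n : ℕ} (ψ : EuclideanSpace ℝ (Fin n) → ℝ) : Prop :=
  (∃ K : ℝ≥0, LipschitzWith K ψ) ∧ ∃ M : ℝ, ∀ x, |ψ x| ≤ M

/-- `Lip(ψ)`: the smallest Lipschitz constant of a Lipschitz function `ψ`. -/
def lipConst {n : ℕ} (ψ : EuclideanSpace ℝ (Fin n) → ℝ) : ℝ≥0 :=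
  sInf {K : ℝ≥0 | LipschitzWith K ψ}

/-- The constant `μ_{n,α} = 2^α π^{-n/2} Γ((n+α+1)/2) / Γ((1-α)/2)`. -/
def mu (n : ℕ) (α : ℝ) : ℝ :=
  2 ^ α * Real.pi ^ (-(n : ℝ) / 2) *
    (Real.Gamma (((n : ℝ) + α + 1) / 2) / Real.Gamma ((1 - α) / 2))

/-- The integrand `(φ(y)-φ(x)) / |y-x|^{n+α} · (y-x)/|y-x|` of the Riesz fractional gradient. -/
def fracGradIntegrand {n : ℕ} (α : ℝ) (φ : EuclideanSpace ℝ (Fin n) → ℝ)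
    (x y : EuclideanSpace ℝ (Fin n)) : EuclideanSpace ℝ (Fin n) :=
  ((φ y - φ x) / ‖y - x‖ ^ ((n : ℝ) + α)) • (‖y - x‖⁻¹ • (y - x))

/-- The Riesz fractional gradient `∇^α φ (x)`. -/
def fracGrad {n : ℕ} (α : ℝ) (φ : EuclideanSpace ℝ (Fin n) → ℝ)
    (x : EuclideanSpace ℝ (Fin n)) : EuclideanSpace ℝ (Fin n) :=
  mu n α • ∫ y, fracGradIntegrand α φ x y

/-- The integrand `(y-x) (φ(y)-φ(x)) (ψ(y)-ψ(x)) / |y-x|^{n+α+1}`. -/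
def fracGradNLIntegrand {n : ℕ} (α : ℝ) (φ ψ : EuclideanSpace ℝ (Fin n) → ℝ)
    (x y : EuclideanSpace ℝ (Fin n)) : EuclideanSpace ℝ (Fin n) :=
  ((φ y - φ x) * (ψ y - ψ x) / ‖y - x‖ ^ ((n : ℝ) + α + 1)) • (y - x)

/-- The nonlocal remainder `∇^α_NL(φ, ψ)(x)` in the fractional Leibniz rule. -/
def fracGradNL {n : ℕ} (α : ℝ) (φ ψ : EuclideanSpace ℝ (Fin n) → ℝ)
    (x : EuclideanSpace ℝ (Fin n)) : EuclideanSpace ℝ (Fin n) :=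
  mu n α • ∫ y, fracGradNLIntegrand α φ ψ x y

/-- `u ∈ L¹(ℝⁿ) + L^∞(ℝⁿ)`. -/
def MemL1AddLinf {n : ℕ} (u : EuclideanSpace ℝ (Fin n) → ℝ) : Prop :=
  ∃ f g : EuclideanSpace ℝ (Fin n) → ℝ,
    MemLp f 1 volume ∧ MemLp g ∞ volume ∧ u =ᵐ[volume] fun x => f x + g x

/-- `v ∈ L¹_loc(ℝⁿ; ℝⁿ)` is the weak `α`-fractional gradient of `u ∈ L¹(ℝⁿ) + L^∞(ℝⁿ)`:
`∫ v φ = - ∫ u ∇^α φ` for all `φ ∈ C_c^∞(ℝⁿ)`. -/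
def IsWeakFracGrad {n : ℕ} (α : ℝ) (u : EuclideanSpace ℝ (Fin n) → ℝ)
    (v : EuclideanSpace ℝ (Fin n) → EuclideanSpace ℝ (Fin n)) : Prop :=
  MemL1AddLinf u ∧ LocallyIntegrable v volume ∧
    ∀ φ : EuclideanSpace ℝ (Fin n) → ℝ, ContDiff ℝ ∞ φ → HasCompactSupport φ →
      ∫ x, φ x • v x = -∫ x, u x • fracGrad α φ x

/-- `u ∈ S^{α,p}(ℝⁿ)`: `u ∈ L^p` has a weak `α`-fractional gradient in `L^p`. -/
def MemFracSobolev {n : ℕ} (α : ℝ) (p : ℝ≥0∞) (u : EuclideanSpace ℝ (Fin n) → ℝ) : Prop :=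
  MemLp u p volume ∧
    ∃ v : EuclideanSpace ℝ (Fin n) → EuclideanSpace ℝ (Fin n),
      IsWeakFracGrad α u v ∧ MemLp v p volume

end RieszFrac

end

/-!
Write `F(x, y)` for the integrand of `∇^α ψ(x)`. If `ψ` is `L`-Lipschitz and bounded by `M`, then
`|F(x, y)| ≤ κ(y - x)` with the radial kernel `κ(h) = min (L|h|) (2M) / |h|^{n+α}`. This kernel is
integrable for `0 < α < 1`, and scaling gives `∫ κ = M^{1-α} L^α ∫ κ₁`, where `κ₁` is the kernel
with `L = M = 1` (`lintegral_incrKernel`).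

*The estimate.* The integrand of `∇^α_NL(u, ψ)(x)` is `(u(y) - u(x)) F(x, y)`, so
`u ∇^α ψ + ∇^α_NL(u, ψ)` is bounded pointwise by a multiple of `2 |u| ∫ κ + κ ∗ |u|`, and Young's
inequality (`eLpNorm_lintegral_translate_mul_le`) bounds its `L^p` norm by
`3 |μ_{n,α}| (∫ κ) ‖u‖_p`, for all `p ∈ [1, ∞]` at once. Young's inequality also shows that the
nonlocal integral converges absolutely almost everywhere.

*The Leibniz rule.* For a test function `φ` the product `φ ψ` is only Lipschitz with compact
support, but mollification shows that it may be used as a test function for the weak gradient of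
`u` (`IsWeakFracGrad.integral_smul_eq_of_isLipB`). Expanding `∇^α (φ ψ)` by the pointwise product
rule leaves the term `∫ u ∇^α_NL(φ, ψ)`. As `F` is symmetric in `x` and `y`, Fubini's theorem turns
it into `∫ φ ∇^α_NL(u, ψ)` (`integral_smul_nonlocal_symm`). Hence
`ψ v + u ∇^α ψ + ∇^α_NL(u, ψ)` is a weak gradient of `ψ u` (`integral_smul_leibniz`), and weak
gradients are unique almost everywhere.

All integrability questions are settled on the product space, by the single dominating function
`|u(x)| (1_B(x) + 1_B(y)) κ(y - x)` with `B` bounded (`lintegral_pairBound_lt_top`).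
-/

namespace RieszFrac

open Filter Topology

variable {n : ℕ} {α : ℝ} {p : ℝ≥0∞}

local notation "𝔼" => EuclideanSpace ℝ (Fin n)

/-! ### The radial kernel -/

/-- The radial kernel `min (L|h|) (2M) / |h|^{n+α}`, as an `ℝ≥0∞`-valued function. It dominates
the integrand of `∇^α ψ` whenever `ψ` is `L`-Lipschitz and bounded by `M`. The value at `h = 0`
is `0`. -/
noncomputable def incrKernel (α : ℝ) (L M : ℝ≥0) (h : 𝔼) : ℝ≥0∞ :=
  ENNReal.ofReal (min (L * ‖h‖) (2 * M) / ‖h‖ ^ ((n : ℝ) + α))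

@[fun_prop]
lemma measurable_incrKernel (L M : ℝ≥0) : Measurable (incrKernel (n := n) α L M) := by
  unfold incrKernel
  fun_prop

lemma incrKernel_neg (L M : ℝ≥0) (h : 𝔼) : incrKernel α L M (-h) = incrKernel α L M h := by
  simp [incrKernel]

/-- The radial profile of `incrKernel α 1 1` in polar coordinates: the cut-off `min r 2` tames the
singularity `r^{-1-α}` at `0` because `α < 1`, and the tail is integrable because `0 < α`. -/
lemma integrableOn_radial_incrKernel (hα0 : 0 < α) (hα1 : α < 1) :
    IntegrableOn (fun r : ℝ => min r 2 * r ^ (-1 - α)) (Set.Ioi 0) := by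
  have hmeas : ∀ s : Set ℝ, AEStronglyMeasurable (fun r : ℝ => min r 2 * r ^ (-1 - α))
      (volume.restrict s) := fun s => by
    apply Measurable.aestronglyMeasurable
    fun_prop
  rw [← Set.Ioc_union_Ioi_eq_Ioi zero_le_one]
  refine IntegrableOn.union ?_ ?_
  · have h := (intervalIntegral.intervalIntegrable_rpow' (a := 0) (b := 1)
      (show -1 < -α by linarith)).1
    refine Integrable.mono' h (hmeas _) ?_
    filter_upwards [ae_restrict_mem measurableSet_Ioc] with r hr
    have hr0 : 0 < r := hr.1
    rw [Real.norm_of_nonneg (by positivity)]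
    calc min r 2 * r ^ (-1 - α) ≤ r * r ^ (-1 - α) := by gcongr; exact min_le_left _ _
      _ = r ^ (-α) := by
        conv_lhs => enter [1]; rw [← Real.rpow_one r]
        rw [← Real.rpow_add hr0]; congr 1; ring
  · have h := (integrableOn_Ioi_rpow_of_lt (show -1 - α < -1 by linarith) zero_lt_one).const_mul 2
    refine Integrable.mono' h (hmeas _) ?_
    filter_upwards [ae_restrict_mem measurableSet_Ioi] with r hr
    have hr0 : 0 < r := lt_trans zero_lt_one hr
    rw [Real.norm_of_nonneg (by positivity)]
    gcongr
    exact min_le_right _ _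

lemma lintegral_incrKernel_one_one_lt_top (hn : 1 ≤ n) (hα0 : 0 < α) (hα1 : α < 1) :
    ∫⁻ h : 𝔼, incrKernel α 1 1 h < ⊤ := by
  have : Nonempty (Fin n) := ⟨⟨0, hn⟩⟩
  have key : Integrable (fun h : 𝔼 => min ‖h‖ 2 / ‖h‖ ^ ((n : ℝ) + α)) := by
    refine (integrable_fun_norm_addHaar (E := 𝔼) volume
      (f := fun r : ℝ => min r 2 / r ^ ((n : ℝ) + α))).2 ?_
    refine (integrableOn_radial_incrKernel hα0 hα1).congr_fun (fun r hr => ?_) measurableSet_Ioi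
    have hr0 : 0 < r := hr
    simp only [finrank_euclideanSpace, Fintype.card_fin, smul_eq_mul]
    rw [← Real.rpow_natCast, Nat.cast_sub hn, Nat.cast_one, div_eq_mul_inv, ← Real.rpow_neg hr0.le,
      mul_left_comm, ← Real.rpow_add hr0]
    congr 2
    ring
  have := key.lintegral_lt_top
  simpa [incrKernel] using this

/-- The substitution `h = (M / L) z` turns `incrKernel α L M` into a multiple of
`incrKernel α 1 1`. This is where the interpolation factor `M^{1-α} L^α` comes from. -/
lemma lintegral_incrKernel (hα0 : 0 < α) (hα1 : α < 1) (L M : ℝ≥0) :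
    ∫⁻ h : 𝔼, incrKernel α L M h
      = (M : ℝ≥0∞) ^ (1 - α) * (L : ℝ≥0∞) ^ α * ∫⁻ h : 𝔼, incrKernel α 1 1 h := by
  rcases eq_or_ne L 0 with rfl | hL
  · simp [incrKernel, hα0]
  rcases eq_or_ne M 0 with rfl | hM
  · have : ∀ h : 𝔼, min ((L : ℝ) * ‖h‖) 0 = 0 := fun h => min_eq_right (by positivity)
    simp [incrKernel, hα1, this]
  have hL' : (0 : ℝ) < L := by positivity
  have hM' : (0 : ℝ) < M := by positivity
  set r : ℝ := M / L with hr
  have hr0 : 0 < r := by positivity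
  have hsc : ∀ z : 𝔼, incrKernel α L M (r • z)
      = ENNReal.ofReal (M * (r ^ ((n : ℝ) + α))⁻¹) * incrKernel α 1 1 z := fun z => by
    unfold incrKernel
    rw [← ENNReal.ofReal_mul (by positivity), norm_smul, Real.norm_of_nonneg hr0.le,
      Real.mul_rpow hr0.le (norm_nonneg _)]
    congr 1
    have h1 : min ((L : ℝ) * (r * ‖z‖)) (2 * M) = M * min ‖z‖ 2 := by
      rw [mul_min_of_nonneg _ _ hM'.le, hr]
      congr 1
      · field_simp
      · ring
    rw [h1]
    simp only [NNReal.coe_one, one_mul, mul_one]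
    field_simp
  have hmap : ∫⁻ z : 𝔼, incrKernel α L M (r • z)
      = ENNReal.ofReal ((r ^ n)⁻¹) * ∫⁻ h : 𝔼, incrKernel α L M h := by
    rw [← lintegral_map (f := incrKernel α L M) (g := fun z : 𝔼 => r • z)
      (by fun_prop) (by fun_prop),
      Measure.map_addHaar_smul _ hr0.ne', lintegral_smul_measure, smul_eq_mul,
      finrank_euclideanSpace, Fintype.card_fin, abs_of_pos (by positivity)]
  simp_rw [hsc] at hmap
  rw [lintegral_const_mul _ (by fun_prop)] at hmap
  have h2 : ∫⁻ h : 𝔼, incrKernel α L M h = ENNReal.ofReal (r ^ n) *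
      (ENNReal.ofReal ((r ^ n)⁻¹) * ∫⁻ h : 𝔼, incrKernel α L M h) := by
    rw [← mul_assoc, ← ENNReal.ofReal_mul (by positivity), mul_inv_cancel₀ (by positivity)]
    simp
  rw [h2, ← hmap, ← mul_assoc, ← ENNReal.ofReal_mul (by positivity)]
  congr 1
  rw [← ENNReal.ofReal_coe_nnreal, ← ENNReal.ofReal_coe_nnreal (p := L),
    ENNReal.ofReal_rpow_of_pos hM', ENNReal.ofReal_rpow_of_pos hL',
    ← ENNReal.ofReal_mul (by positivity)]
  congr 1
  rw [Real.rpow_add hr0, Real.rpow_natCast, hr, Real.div_rpow hM'.le hL'.le,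
    Real.rpow_sub hM', Real.rpow_one]
  field_simp

/-! ### Young's inequality -/

/-- **Young's convolution inequality** `‖k ∗ f‖_p ≤ ‖k‖₁ ‖f‖_p` for non-negative functions. -/
lemma eLpNorm_lintegral_translate_mul_le {k f : 𝔼 → ℝ≥0∞} (hk : Measurable k)
    (hf : AEMeasurable f) (hp : 1 ≤ p) :
    eLpNorm (fun x => ∫⁻ y, k (y - x) * f y) p volume ≤ (∫⁻ h, k h) * eLpNorm f p volume := by
  have htrans : ∀ x : 𝔼, ∫⁻ y, k (y - x) = ∫⁻ h, k h := fun x => lintegral_sub_right_eq_self k x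
  rcases eq_or_ne p ∞ with rfl | hp_top
  · rw [eLpNorm_exponent_top]
    refine eLpNormEssSup_le_of_ae_enorm_bound (ae_of_all _ fun x => ?_)
    rw [enorm_eq_self, ← htrans x, ← lintegral_mul_const _ (by fun_prop), eLpNorm_exponent_top]
    refine lintegral_mono_ae ?_
    filter_upwards [enorm_ae_le_eLpNormEssSup f volume] with y hy
    gcongr
    simpa using hy
  set s := p.toReal with hs
  have hs1 : 1 ≤ s := by
    rw [hs]; exact (ENNReal.toReal_mono hp_top hp).trans' (by simp)
  have hs0 : 0 < s := by linarith
  have hp0 : p ≠ 0 := (zero_lt_one.trans_le hp).ne'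
  -- Hölder's inequality with respect to the measure with density `k (· - x)`
  have hJ : ∀ x, (∫⁻ y, k (y - x) * f y) ^ s
      ≤ (∫⁻ h, k h) ^ (s - 1) * ∫⁻ y, k (y - x) * f y ^ s := fun x => by
    rcases hs1.eq_or_lt with h1 | h1
    · simp [← h1]
    have hpq : s.HolderConjugate (s / (s - 1)) := Real.HolderConjugate.conjExponent h1
    have hH := ENNReal.lintegral_mul_le_Lp_mul_Lq volume hpq.symm
      (f := fun y => k (y - x) ^ (1 / (s / (s - 1)))) (g := fun y => k (y - x) ^ (1 / s) * f y)
      (by fun_prop) (by fun_prop)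
    have e1 : ∀ y, k (y - x) ^ (1 / (s / (s - 1))) * (k (y - x) ^ (1 / s) * f y)
        = k (y - x) * f y := fun y => by
      rw [← mul_assoc, ← ENNReal.rpow_add_of_nonneg _ _ hpq.symm.one_div_nonneg (by positivity)]
      rw [show 1 / (s / (s - 1)) + 1 / s = 1 by field_simp; ring, ENNReal.rpow_one]
    have e2 : ∀ y, (k (y - x) ^ (1 / (s / (s - 1)))) ^ (s / (s - 1)) = k (y - x) := fun y => by
      rw [← ENNReal.rpow_mul, one_div_mul_cancel hpq.symm.pos.ne', ENNReal.rpow_one]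
    have e3 : ∀ y, (k (y - x) ^ (1 / s) * f y) ^ s = k (y - x) * f y ^ s := fun y => by
      rw [ENNReal.mul_rpow_of_nonneg _ _ hs0.le, ← ENNReal.rpow_mul, one_div_mul_cancel hs0.ne',
        ENNReal.rpow_one]
    simp only [Pi.mul_apply, e1, e2, e3, htrans] at hH
    calc _ ≤ _ := ENNReal.rpow_le_rpow hH hs0.le
      _ = _ := by
        rw [ENNReal.mul_rpow_of_nonneg _ _ hs0.le, ← ENNReal.rpow_mul, ← ENNReal.rpow_mul,
          one_div_mul_cancel hs0.ne', ENNReal.rpow_one]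
        congr 2
        field_simp
  have hmeas : AEMeasurable (fun z : 𝔼 × 𝔼 => k (z.2 - z.1) * f z.2 ^ s)
      (volume.prod volume) := by
    have := hf.comp_snd (μ := (volume : Measure 𝔼))
    fun_prop
  rw [eLpNorm_eq_lintegral_rpow_enorm_toReal hp0 hp_top,
    eLpNorm_eq_lintegral_rpow_enorm_toReal hp0 hp_top, ← hs]
  simp only [enorm_eq_self]
  calc (∫⁻ x, (∫⁻ y, k (y - x) * f y) ^ s) ^ (1 / s)
      ≤ (∫⁻ x, (∫⁻ h, k h) ^ (s - 1) * ∫⁻ y, k (y - x) * f y ^ s) ^ (1 / s) := by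
        gcongr with x; exact hJ x
    _ = ((∫⁻ h, k h) ^ (s - 1) * ∫⁻ x, ∫⁻ y, k (y - x) * f y ^ s) ^ (1 / s) := by
        rw [lintegral_const_mul'' _ hmeas.lintegral_prod_right']
    _ = ((∫⁻ h, k h) ^ s * ∫⁻ y, f y ^ s) ^ (1 / s) := by
        rw [lintegral_lintegral_swap hmeas]
        have : ∀ y, ∫⁻ x, k (y - x) * f y ^ s = (∫⁻ h, k h) * f y ^ s := fun y => by
          rw [lintegral_mul_const _ (by fun_prop), lintegral_sub_left_eq_self k y]
        simp_rw [this]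
        rw [lintegral_const_mul'' _ (hf.pow_const s), ← mul_assoc]
        congr 2
        conv_rhs => rw [show s = (s - 1) + 1 by ring,
          ENNReal.rpow_add_of_nonneg _ _ (by linarith) zero_le_one, ENNReal.rpow_one]
    _ = (∫⁻ h, k h) * (∫⁻ y, f y ^ s) ^ (1 / s) := by
        rw [ENNReal.mul_rpow_of_nonneg _ _ (by positivity), ← ENNReal.rpow_mul,
          mul_one_div_cancel hs0.ne', ENNReal.rpow_one]

/-! ### Functions with bounded increments -/

/-- The bound `|ψ y - ψ x| ≤ min (L|y - x|) (2M)` on increments, satisfied by every function that is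
`L`-Lipschitz and bounded by `M`. It is all that the kernel estimates use. -/
def IncrementBound (ψ : 𝔼 → ℝ) (L M : ℝ≥0) : Prop :=
  ∀ x y, |ψ y - ψ x| ≤ min (L * ‖y - x‖) (2 * M)

lemma IncrementBound.of_lipschitzWith {ψ : 𝔼 → ℝ} {L M : ℝ≥0} (hL : LipschitzWith L ψ)
    (hM : ∀ x, |ψ x| ≤ M) : IncrementBound ψ L M := fun x y => by
  refine le_min ?_ ?_
  · simpa [Real.dist_eq, dist_eq_norm] using hL.dist_le_mul y x
  · calc |ψ y - ψ x| ≤ |ψ y| + |ψ x| := abs_sub _ _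
      _ ≤ 2 * M := by linarith [hM x, hM y]

lemma IncrementBound.lipschitzWith {ψ : 𝔼 → ℝ} {L M : ℝ≥0} (h : IncrementBound ψ L M) :
    LipschitzWith L ψ :=
  LipschitzWith.of_dist_le_mul fun x y => by
    simpa [Real.dist_eq, dist_eq_norm] using (h y x).trans (min_le_left _ _)

lemma IncrementBound.continuous {ψ : 𝔼 → ℝ} {L M : ℝ≥0} (h : IncrementBound ψ L M) :
    Continuous ψ := h.lipschitzWith.continuous

lemma IsLipB.exists_bounds {ψ : 𝔼 → ℝ} (h : IsLipB ψ) :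
    ∃ L M : ℝ≥0, IncrementBound ψ L M ∧ ∀ x, |ψ x| ≤ M := by
  obtain ⟨⟨K, hK⟩, M, hM⟩ := h
  have hM0 : 0 ≤ M := (abs_nonneg _).trans (hM 0)
  exact ⟨K, ⟨M, hM0⟩, .of_lipschitzWith hK hM, hM⟩

lemma IsLipB.mul {φ ψ : 𝔼 → ℝ} (hφ : IsLipB φ) (hψ : IsLipB ψ) : IsLipB (fun x => φ x * ψ x) := by
  obtain ⟨L, M, h, hM⟩ := hφ.exists_bounds
  obtain ⟨L', M', h', hM'⟩ := hψ.exists_bounds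
  refine ⟨⟨M * L' + M' * L, LipschitzWith.of_dist_le_mul fun x y => ?_⟩, M * M', fun x => ?_⟩
  · have h1 : |φ x - φ y| ≤ L * ‖x - y‖ := (h y x).trans (min_le_left _ _)
    have h2 : |ψ x - ψ y| ≤ L' * ‖x - y‖ := (h' y x).trans (min_le_left _ _)
    rw [Real.dist_eq, dist_eq_norm]
    push_cast
    calc |φ x * ψ x - φ y * ψ y| = |φ x * (ψ x - ψ y) + ψ y * (φ x - φ y)| := by ring_nf
      _ ≤ |φ x| * |ψ x - ψ y| + |ψ y| * |φ x - φ y| := by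
        rw [← abs_mul, ← abs_mul]; exact abs_add_le _ _
      _ ≤ M * (L' * ‖x - y‖) + M' * (L * ‖x - y‖) := by
        gcongr
        · exact hM x
        · exact hM' y
      _ = _ := by ring
  · rw [abs_mul]
    exact mul_le_mul (hM x) (hM' x) (abs_nonneg _) M.2

lemma isLipB_of_contDiff_of_hasCompactSupport {φ : 𝔼 → ℝ} (hφ : ContDiff ℝ ∞ φ)
    (hc : HasCompactSupport φ) : IsLipB φ := by
  obtain ⟨K, hK⟩ := (hφ.of_le (by simp)).lipschitzWith_of_hasCompactSupport (n := 1) hc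
    one_ne_zero
  obtain ⟨M, hM⟩ := hc.exists_bound_of_continuous hφ.continuous
  exact ⟨⟨K, hK⟩, M, hM⟩

/-! ### Algebra and pointwise bounds of the integrands -/

/-- Both `ψ y - ψ x` and the kernel are odd under `x ↔ y`, so the integrand is symmetric. -/
lemma fracGradIntegrand_symm (φ : 𝔼 → ℝ) (x y : 𝔼) :
    fracGradIntegrand α φ x y = fracGradIntegrand α φ y x := by
  unfold fracGradIntegrand
  rw [← neg_sub x y, norm_neg, ← neg_sub (φ x) (φ y), neg_div, smul_neg, smul_neg,
    neg_smul, neg_neg]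

lemma fracGradNLIntegrand_eq (φ ψ : 𝔼 → ℝ) (x y : 𝔼) :
    fracGradNLIntegrand α φ ψ x y = (φ y - φ x) • fracGradIntegrand α ψ x y := by
  unfold fracGradNLIntegrand fracGradIntegrand
  rcases eq_or_ne y x with rfl | h
  · simp
  have h0 : ‖y - x‖ ≠ 0 := norm_ne_zero_iff.2 (sub_ne_zero.2 h)
  rw [smul_smul, smul_smul, Real.rpow_add_one h0]
  congr 1
  field_simp

/-- The pointwise product rule for difference quotients; the last term is the nonlocal one. -/
lemma fracGradIntegrand_mul (φ ψ : 𝔼 → ℝ) (x y : 𝔼) :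
    fracGradIntegrand α (fun z => φ z * ψ z) x y = ψ x • fracGradIntegrand α φ x y
      + φ x • fracGradIntegrand α ψ x y + (φ y - φ x) • fracGradIntegrand α ψ x y := by
  unfold fracGradIntegrand
  simp only [smul_smul, ← add_smul]
  congr 1
  ring

lemma enorm_fracGradIntegrand_le {ψ : 𝔼 → ℝ} {L M : ℝ≥0} (h : IncrementBound ψ L M) (x y : 𝔼) :
    ‖fracGradIntegrand α ψ x y‖ₑ ≤ incrKernel α L M (y - x) := by
  rw [incrKernel, ← ofReal_norm]
  apply ENNReal.ofReal_le_ofReal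
  rw [fracGradIntegrand, norm_smul, norm_smul, norm_inv, norm_norm, norm_div,
    Real.norm_of_nonneg (Real.rpow_nonneg (norm_nonneg (y - x)) _), Real.norm_eq_abs]
  have h1 : ‖y - x‖⁻¹ * ‖y - x‖ ≤ 1 := inv_mul_le_one
  calc _ ≤ |ψ y - ψ x| / ‖y - x‖ ^ ((n : ℝ) + α) * 1 := by gcongr
    _ ≤ _ := by rw [mul_one]; gcongr; exact h x y

@[fun_prop]
lemma measurable_fracGradIntegrand {ψ : 𝔼 → ℝ} (h : Continuous ψ) :
    Measurable (fun z : 𝔼 × 𝔼 => fracGradIntegrand α ψ z.1 z.2) := by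
  have := h.measurable
  unfold fracGradIntegrand
  fun_prop

lemma lintegral_enorm_fracGradIntegrand_le {ψ : 𝔼 → ℝ} {L M : ℝ≥0} (h : IncrementBound ψ L M)
    (x : 𝔼) : ∫⁻ y, ‖fracGradIntegrand α ψ x y‖ₑ ≤ ∫⁻ y : 𝔼, incrKernel α L M y := by
  rw [← lintegral_sub_right_eq_self (incrKernel α L M) x]
  exact lintegral_mono fun y => enorm_fracGradIntegrand_le h x y

lemma lintegral_incrKernel_lt_top (hn : 1 ≤ n) (hα0 : 0 < α) (hα1 : α < 1) (L M : ℝ≥0) :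
    ∫⁻ h : 𝔼, incrKernel α L M h < ⊤ := by
  rw [lintegral_incrKernel hα0 hα1]
  refine ENNReal.mul_lt_top (ENNReal.mul_lt_top ?_ ?_)
    (lintegral_incrKernel_one_one_lt_top hn hα0 hα1)
  · exact ENNReal.rpow_lt_top_of_nonneg (by linarith) ENNReal.coe_ne_top
  · exact ENNReal.rpow_lt_top_of_nonneg hα0.le ENNReal.coe_ne_top

lemma integrable_fracGradIntegrand (hn : 1 ≤ n) (hα0 : 0 < α) (hα1 : α < 1) {ψ : 𝔼 → ℝ}
    (h : IsLipB ψ) (x : 𝔼) : Integrable (fracGradIntegrand α ψ x) := by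
  obtain ⟨L, M, h, -⟩ := h.exists_bounds
  have hm := (measurable_fracGradIntegrand (α := α) h.continuous).comp
    (measurable_prodMk_left (x := x))
  exact ⟨hm.aestronglyMeasurable,
    (lintegral_enorm_fracGradIntegrand_le h x).trans_lt (lintegral_incrKernel_lt_top hn hα0 hα1 L M)⟩

lemma enorm_fracGrad_le {ψ : 𝔼 → ℝ} {L M : ℝ≥0} (h : IncrementBound ψ L M) (x : 𝔼) :
    ‖fracGrad α ψ x‖ₑ ≤ ‖mu n α‖ₑ * ∫⁻ y : 𝔼, incrKernel α L M y := by
  rw [fracGrad, enorm_smul]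
  gcongr
  exact (enorm_integral_le_lintegral_enorm _).trans (lintegral_enorm_fracGradIntegrand_le h x)

lemma aestronglyMeasurable_fracGrad {ψ : 𝔼 → ℝ} (h : Continuous ψ) :
    AEStronglyMeasurable (fracGrad α ψ) volume := by
  have := (measurable_fracGradIntegrand (α := α) h).aestronglyMeasurable
    (μ := (volume : Measure 𝔼).prod volume)
  exact this.integral_prod_right'.const_smul (mu n α)

/-! ### Estimates of the nonlocal gradient -/

lemma lintegral_enorm_fracGradNLIntegrand_le {u ψ : 𝔼 → ℝ} {L M : ℝ≥0}
    (hu : AEStronglyMeasurable u volume) (h : IncrementBound ψ L M) (x : 𝔼) :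
    ∫⁻ y, ‖fracGradNLIntegrand α u ψ x y‖ₑ ≤ (∫⁻ y, incrKernel α L M (y - x) * ‖u y‖ₑ)
      + (∫⁻ y : 𝔼, incrKernel α L M y) * ‖u x‖ₑ := by
  rw [← lintegral_sub_right_eq_self (incrKernel α L M) x, ← lintegral_mul_const _ (by fun_prop),
    ← lintegral_add_left' (by fun_prop)]
  refine lintegral_mono fun y => ?_
  rw [fracGradNLIntegrand_eq, enorm_smul, ← mul_add, mul_comm]
  gcongr
  · exact enorm_fracGradIntegrand_le h x y
  · exact enorm_sub_le

lemma aestronglyMeasurable_fracGradNLIntegrand {u ψ : 𝔼 → ℝ}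
    (hu : AEStronglyMeasurable u volume) (h : Continuous ψ) :
    AEStronglyMeasurable (fun z : 𝔼 × 𝔼 => fracGradNLIntegrand α u ψ z.1 z.2)
      (volume.prod volume) := by
  simp_rw [fracGradNLIntegrand_eq]
  exact (hu.comp_snd.sub hu.comp_fst).smul
    (measurable_fracGradIntegrand h).aestronglyMeasurable

lemma eLpNorm_lintegral_incrKernel_mul_le {u : 𝔼 → ℝ} (hu : AEStronglyMeasurable u volume)
    (hp : 1 ≤ p) (L M : ℝ≥0) :
    eLpNorm (fun x => ∫⁻ y, incrKernel α L M (y - x) * ‖u y‖ₑ) p volume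
      ≤ (∫⁻ h : 𝔼, incrKernel α L M h) * eLpNorm u p volume := by
  have := eLpNorm_lintegral_translate_mul_le (measurable_incrKernel (α := α) L M) hu.enorm hp
  rwa [eLpNorm_enorm] at this

lemma aemeasurable_lintegral_incrKernel_mul {u : 𝔼 → ℝ} (hu : AEStronglyMeasurable u volume)
    (L M : ℝ≥0) :
    AEMeasurable (fun x => ∫⁻ y, incrKernel α L M (y - x) * ‖u y‖ₑ) := by
  have h1 := hu.enorm.comp_snd (μ := (volume : Measure 𝔼))
  have h2 : AEMeasurable (fun z : 𝔼 × 𝔼 => incrKernel α L M (z.2 - z.1) * ‖u z.2‖ₑ)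
      (volume.prod volume) := by fun_prop
  exact h2.lintegral_prod_right'

lemma ae_integrable_fracGradNLIntegrand (hn : 1 ≤ n) (hα0 : 0 < α) (hα1 : α < 1) (hp : 1 ≤ p)
    {u ψ : 𝔼 → ℝ} (hu : MemLp u p volume) (h : IsLipB ψ) :
    ∀ᵐ x ∂(volume : Measure 𝔼), Integrable (fracGradNLIntegrand α u ψ x) := by
  obtain ⟨L, M, h, -⟩ := h.exists_bounds
  have hκ := lintegral_incrKernel_lt_top hn hα0 hα1 L M
  have hlt : eLpNorm (fun x => ∫⁻ y, incrKernel α L M (y - x) * ‖u y‖ₑ) p volume < ⊤ :=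
    (eLpNorm_lintegral_incrKernel_mul_le hu.1 hp L M).trans_lt (ENNReal.mul_lt_top hκ hu.2)
  have hfin : ∀ᵐ x ∂(volume : Measure 𝔼), ∫⁻ y, incrKernel α L M (y - x) * ‖u y‖ₑ < ⊤ := by
    have hp0 : p ≠ 0 := (zero_lt_one.trans_le hp).ne'
    rcases eq_or_ne p ⊤ with rfl | hpt
    · rw [eLpNorm_exponent_top] at hlt
      filter_upwards [enorm_ae_le_eLpNormEssSup
        (fun x => ∫⁻ y, incrKernel α L M (y - x) * ‖u y‖ₑ) volume] with x hx
      exact hx.trans_lt hlt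
    · have := lintegral_rpow_enorm_lt_top_of_eLpNorm_lt_top hp0 hpt hlt
      have hps := ENNReal.toReal_pos hp0 hpt
      filter_upwards [ae_lt_top' ((aemeasurable_lintegral_incrKernel_mul hu.1 L M).enorm.pow_const _)
        this.ne] with x hx
      simpa [hps, ENNReal.rpow_lt_top_iff_of_pos] using hx
  filter_upwards [hfin, (aestronglyMeasurable_fracGradNLIntegrand (α := α) hu.1
    h.continuous).prodMk_left] with x hx hm
  exact ⟨hm, (lintegral_enorm_fracGradNLIntegrand_le hu.1 h x).trans_lt
    (ENNReal.add_lt_top.2 ⟨hx, ENNReal.mul_lt_top hκ enorm_lt_top⟩)⟩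

lemma enorm_fracGradNL_le {u ψ : 𝔼 → ℝ} {L M : ℝ≥0}
    (hu : AEStronglyMeasurable u volume) (h : IncrementBound ψ L M) (x : 𝔼) :
    ‖fracGradNL α u ψ x‖ₑ ≤ ‖mu n α‖ₑ * ((∫⁻ y, incrKernel α L M (y - x) * ‖u y‖ₑ)
      + (∫⁻ y : 𝔼, incrKernel α L M y) * ‖u x‖ₑ) := by
  rw [fracGradNL, enorm_smul]
  gcongr
  exact (enorm_integral_le_lintegral_enorm _).trans (lintegral_enorm_fracGradNLIntegrand_le hu h x)

lemma aestronglyMeasurable_fracGradNL {u ψ : 𝔼 → ℝ} (hu : AEStronglyMeasurable u volume)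
    (h : Continuous ψ) : AEStronglyMeasurable (fracGradNL α u ψ) volume :=
  (aestronglyMeasurable_fracGradNLIntegrand hu h).integral_prod_right'.const_smul (mu n α)

/-- The `L^p` estimate of the commutator: `u ∇^α ψ` and the diagonal part of `∇^α_NL(u, ψ)` are
bounded pointwise by `|u|` times the mass of the kernel, and the remaining part is a convolution. -/
lemma eLpNorm_smul_fracGrad_add_fracGradNL_le (hp : 1 ≤ p) {u ψ : 𝔼 → ℝ} {L M : ℝ≥0}
    (hu : AEStronglyMeasurable u volume) (h : IncrementBound ψ L M) :
    eLpNorm (fun x => u x • fracGrad α ψ x + fracGradNL α u ψ x) p volume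
      ≤ 3 * ‖mu n α‖ₑ * (∫⁻ y : 𝔼, incrKernel α L M y) * eLpNorm u p volume := by
  set κ := ∫⁻ y : 𝔼, incrKernel α L M y with hκ
  set T : 𝔼 → ℝ≥0∞ := fun x => ∫⁻ y, incrKernel α L M (y - x) * ‖u y‖ₑ with hT
  have hb : ∀ x, ‖u x • fracGrad α ψ x + fracGradNL α u ψ x‖ₑ
      ≤ ‖mu n α‖ₑ * (T x + 2 * κ * ‖u x‖ₑ) := fun x => by
    calc _ ≤ ‖u x • fracGrad α ψ x‖ₑ + ‖fracGradNL α u ψ x‖ₑ := enorm_add_le _ _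
      _ ≤ ‖u x‖ₑ * (‖mu n α‖ₑ * κ) + ‖mu n α‖ₑ * (T x + κ * ‖u x‖ₑ) := by
        rw [enorm_smul]
        gcongr
        · exact enorm_fracGrad_le h x
        · exact enorm_fracGradNL_le hu h x
      _ = _ := by ring
  have hT_meas : AEMeasurable T := aemeasurable_lintegral_incrKernel_mul hu L M
  have hu_meas : AEStronglyMeasurable (fun x => ‖u x‖ₑ) volume := hu.enorm.aestronglyMeasurable
  have hκu_meas : AEStronglyMeasurable (fun x => 2 * κ * ‖u x‖ₑ) volume :=
    (hu.enorm.const_mul _).aestronglyMeasurable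
  calc _ ≤ ‖mu n α‖ₑ * eLpNorm (T + fun x => 2 * κ * ‖u x‖ₑ) p volume :=
        eLpNorm_le_mul_eLpNorm_of_ae_le_mul'' p (hT_meas.aestronglyMeasurable.add hκu_meas)
          (ae_of_all _ hb)
    _ ≤ ‖mu n α‖ₑ * (κ * eLpNorm u p volume + 2 * κ * eLpNorm (fun x => ‖u x‖ₑ) p volume) := by
        gcongr
        refine (eLpNorm_add_le hT_meas.aestronglyMeasurable hκu_meas hp).trans ?_
        gcongr
        · exact eLpNorm_lintegral_incrKernel_mul_le hu hp L M
        · exact eLpNorm_le_mul_eLpNorm_of_ae_le_mul'' p hu_meas (ae_of_all _ fun x => by simp)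
    _ = _ := by
        rw [eLpNorm_enorm]
        ring

/-! ### Integrability on the product space -/

/-- For `z = (x, y)`, the function `|u(x)| (1_B(x) + 1_B(y)) κ(y - x)` with `κ = incrKernel α L M`.
It dominates `u(x)` times the integrand of `∇^α g(x)` for every `g` vanishing off `B` whose
increments satisfy `IncrementBound g L M`. -/
noncomputable def pairBound (α : ℝ) (L M : ℝ≥0) (B : Set 𝔼) (u : 𝔼 → ℝ) (z : 𝔼 × 𝔼) : ℝ≥0∞ :=
  ‖u z.1‖ₑ * (B.indicator 1 z.1 + B.indicator 1 z.2) * incrKernel α L M (z.2 - z.1)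

lemma aemeasurable_pairBound {u : 𝔼 → ℝ} (hu : AEStronglyMeasurable u volume) {B : Set 𝔼}
    (hB : MeasurableSet B) (L M : ℝ≥0) :
    AEMeasurable (pairBound α L M B u) (volume.prod volume) := by
  have hind : Measurable (B.indicator (1 : 𝔼 → ℝ≥0∞)) := measurable_one.indicator hB
  have hu' := hu.enorm.comp_fst (ν := (volume : Measure 𝔼))
  unfold pairBound
  fun_prop

/-- By Tonelli, the part with `1_B(x)` integrates to the mass of the kernel times `∫_B |u|`, and the
part with `1_B(y)` to `∫_B κ ∗ |u|`, which is finite as `κ ∗ |u| ∈ L^p` by Young's inequality. -/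
lemma lintegral_pairBound_lt_top (hn : 1 ≤ n) (hα0 : 0 < α) (hα1 : α < 1) (hp : 1 ≤ p)
    {u : 𝔼 → ℝ} (hu : MemLp u p volume) {B : Set 𝔼} (hB : MeasurableSet B)
    (hBfin : volume B ≠ ⊤) (L M : ℝ≥0) :
    ∫⁻ z, pairBound α L M B u z ∂((volume : Measure 𝔼).prod volume) < ⊤ := by
  have hκ := lintegral_incrKernel_lt_top hn hα0 hα1 L M
  have hlt : eLpNorm (fun x => ∫⁻ y, incrKernel α L M (y - x) * ‖u y‖ₑ) p volume < ⊤ :=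
    (eLpNorm_lintegral_incrKernel_mul_le hu.1 hp L M).trans_lt (ENNReal.mul_lt_top hκ hu.2)
  have hT : MemLp (fun x => ∫⁻ y, incrKernel α L M (y - x) * ‖u y‖ₑ) p volume :=
    ⟨(aemeasurable_lintegral_incrKernel_mul hu.1 L M).aestronglyMeasurable, hlt⟩
  have : IsFiniteMeasure ((volume : Measure 𝔼).restrict B) := ⟨by simpa using hBfin.lt_top⟩
  have hT1 : ∫⁻ x in B, ∫⁻ y, incrKernel α L M (y - x) * ‖u y‖ₑ < ⊤ := by
    simpa [eLpNorm_one_eq_lintegral_enorm] using ((hT.restrict B).mono_exponent hp).2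
  have hu1 : ∫⁻ x in B, ‖u x‖ₑ < ⊤ := by
    simpa [eLpNorm_one_eq_lintegral_enorm] using ((hu.restrict B).mono_exponent hp).2
  have hind : Measurable (B.indicator (1 : 𝔼 → ℝ≥0∞)) := measurable_one.indicator hB
  have hue := hu.1.enorm
  have hu' := hue.comp_fst (ν := (volume : Measure 𝔼))
  have hm1 : AEMeasurable
      (fun z : 𝔼 × 𝔼 => ‖u z.1‖ₑ * B.indicator 1 z.1 * incrKernel α L M (z.2 - z.1))
      (volume.prod volume) := by fun_prop
  have hm2 : AEMeasurable
      (fun z : 𝔼 × 𝔼 => ‖u z.1‖ₑ * B.indicator 1 z.2 * incrKernel α L M (z.2 - z.1))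
      (volume.prod volume) := by fun_prop
  have hind_mul : ∀ (f : 𝔼 → ℝ≥0∞) x, f x * B.indicator 1 x = B.indicator f x := fun f x => by
    by_cases hx : x ∈ B <;> simp [hx]
  simp only [pairBound, mul_add, add_mul]
  rw [lintegral_add_left' hm1, lintegral_prod _ hm1, lintegral_prod_symm _ hm2]
  refine ENNReal.add_lt_top.2 ⟨?_, ?_⟩
  · have : ∀ x : 𝔼, ∫⁻ y, ‖u x‖ₑ * B.indicator 1 x * incrKernel α L M (y - x)
        = B.indicator (fun x => ‖u x‖ₑ) x * ∫⁻ h : 𝔼, incrKernel α L M h := fun x => by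
      rw [lintegral_const_mul _ (by fun_prop), lintegral_sub_right_eq_self (incrKernel α L M) x,
        hind_mul (fun x => ‖u x‖ₑ)]
    simp_rw [this]
    rw [lintegral_mul_const'' _ (hue.indicator hB), lintegral_indicator hB]
    exact ENNReal.mul_lt_top hu1 hκ
  · have : ∀ y : 𝔼, ∫⁻ x, ‖u x‖ₑ * B.indicator 1 y * incrKernel α L M (y - x)
        = B.indicator (fun x => ∫⁻ y, incrKernel α L M (y - x) * ‖u y‖ₑ) y := fun y => by
      rw [← hind_mul (fun x => ∫⁻ y, incrKernel α L M (y - x) * ‖u y‖ₑ),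
        ← lintegral_mul_const'' _ (by fun_prop)]
      refine lintegral_congr fun x => ?_
      rw [← incrKernel_neg, neg_sub]
      ring
    simp_rw [this]
    rwa [lintegral_indicator hB]

lemma pairBound_ne_top (L M : ℝ≥0) (B : Set 𝔼) (u : 𝔼 → ℝ) (z : 𝔼 × 𝔼) :
    pairBound α L M B u z ≠ ⊤ := by
  have hi : ∀ x, B.indicator (1 : 𝔼 → ℝ≥0∞) x ≠ ⊤ := fun x => by
    by_cases hx : x ∈ B <;> simp [hx]
  exact ENNReal.mul_ne_top (ENNReal.mul_ne_top enorm_ne_top (ENNReal.add_ne_top.2 ⟨hi _, hi _⟩))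
    ENNReal.ofReal_ne_top

lemma integrable_of_enorm_le_pairBound (hn : 1 ≤ n) (hα0 : 0 < α) (hα1 : α < 1) (hp : 1 ≤ p)
    {u : 𝔼 → ℝ} (hu : MemLp u p volume) {B : Set 𝔼} (hB : MeasurableSet B)
    (hBfin : volume B ≠ ⊤) {L M C : ℝ≥0} {f : 𝔼 × 𝔼 → 𝔼}
    (hf : AEStronglyMeasurable f (volume.prod volume))
    (hb : ∀ z, ‖f z‖ₑ ≤ C * pairBound α L M B u z) :
    Integrable f (volume.prod volume) := by
  refine ⟨hf, (lintegral_mono hb).trans_lt ?_⟩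
  rw [lintegral_const_mul' _ _ ENNReal.coe_ne_top]
  exact ENNReal.mul_lt_top ENNReal.coe_lt_top
    (lintegral_pairBound_lt_top hn hα0 hα1 hp hu hB hBfin L M)

/-! ### Lipschitz test functions -/

/-- Mollification of a compactly supported bounded Lipschitz function: the approximants keep the
bounds and share one ball outside which they vanish. -/
lemma exists_smooth_approx {g : 𝔼 → ℝ} {L M K : ℝ≥0} (h : IncrementBound g L M)
    (hK : ∀ x, |g x| ≤ K) (hc : HasCompactSupport g) :
    ∃ (R : ℝ) (G : ℕ → 𝔼 → ℝ), (∀ k, ContDiff ℝ ∞ (G k)) ∧ (∀ k, IncrementBound (G k) L M) ∧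
      (∀ k x, |G k x| ≤ K) ∧ (∀ k x, x ∉ Metric.closedBall (0 : 𝔼) R → G k x = 0) ∧
      (∀ x, Tendsto (fun k => G k x) atTop (𝓝 (g x))) := by
  have hcont := h.continuous
  let φ : ℕ → ContDiffBump (0 : 𝔼) := fun k =>
    ⟨1 / (2 * (k + 1)), 1 / (k + 1), by positivity, by
      gcongr; linarith [Nat.cast_nonneg (α := ℝ) k]⟩
  have hφ : Tendsto (fun k => (φ k).rOut) atTop (𝓝 0) := tendsto_one_div_add_atTop_nhds_zero_nat
  have hφ1 : ∀ k, (φ k).rOut ≤ 1 := fun k => by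
    change 1 / ((k : ℝ) + 1) ≤ 1
    rw [div_le_one (by positivity)]
    linarith [Nat.cast_nonneg (α := ℝ) k]
  obtain ⟨R, hR⟩ := hc.isCompact.isBounded.subset_closedBall 0
  let G : ℕ → 𝔼 → ℝ := fun k =>
    convolution ((φ k).normed volume) g (ContinuousLinearMap.lsmul ℝ ℝ) volume
  have hG : ∀ k x, G k x = ∫ t : 𝔼, (φ k).normed volume t * g (x - t) := fun k x => by
    simp [G, convolution_def]
  have hint : ∀ k x, Integrable (fun t : 𝔼 => (φ k).normed volume t * g (x - t)) := fun k x =>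
    by
    have := (φ k).integrable_normed (μ := (volume : Measure 𝔼))
    exact this.mul_bdd (c := K) (by fun_prop) (ae_of_all _ fun t => hK _)
  -- averages of a bounded function satisfy the same bound
  have hav : ∀ k (f : 𝔼 → ℝ) (c : ℝ), (∀ t, |f t| ≤ c) →
      |∫ t : 𝔼, (φ k).normed volume t * f t| ≤ c := fun k f c hf => by
    calc |∫ t : 𝔼, (φ k).normed volume t * f t|
        ≤ ∫ t : 𝔼, (φ k).normed volume t * c := by
          rw [← Real.norm_eq_abs]
          refine norm_integral_le_of_norm_le
            (((φ k).integrable_normed (μ := (volume : Measure 𝔼))).mul_const c)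
            (ae_of_all _ fun t => ?_)
          rw [norm_mul, Real.norm_of_nonneg ((φ k).nonneg_normed t)]
          exact mul_le_mul_of_nonneg_left (hf t) ((φ k).nonneg_normed t)
      _ = c := by rw [integral_mul_const, (φ k).integral_normed, one_mul]
  refine ⟨R + 1, G, fun k => ?_, fun k x y => ?_, fun k x => ?_, fun k x hx => ?_, fun x => ?_⟩
  · exact (φ k).hasCompactSupport_normed.contDiff_convolution_left _ (φ k).contDiff_normed
      hcont.locallyIntegrable
  · rw [hG, hG, ← integral_sub (hint k y) (hint k x)]
    simp_rw [← mul_sub]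
    refine hav k _ _ fun t => ?_
    simpa using h (x - t) (y - t)
  · rw [hG]
    exact hav k _ _ fun t => hK _
  · by_contra hne
    obtain ⟨a, ha, b, hb, rfl⟩ := support_convolution_subset (ContinuousLinearMap.lsmul ℝ ℝ) hne
    apply hx
    rw [(φ k).support_normed_eq] at ha
    have h1 : ‖a‖ < 1 := (mem_ball_zero_iff.1 ha).trans_le (hφ1 k)
    have h2 : ‖b‖ ≤ R := mem_closedBall_zero_iff.1 (hR (subset_tsupport _ hb))
    rw [mem_closedBall_zero_iff]
    exact (norm_add_le _ _).trans (by linarith)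
  · exact ContDiffBump.convolution_tendsto_right_of_continuous hφ hcont x

lemma enorm_smul_fracGradIntegrand_le_pairBound {u g : 𝔼 → ℝ} {L M : ℝ≥0}
    (h : IncrementBound g L M) {B : Set 𝔼} (hgB : ∀ x, x ∉ B → g x = 0) (z : 𝔼 × 𝔼) :
    ‖u z.1 • fracGradIntegrand α g z.1 z.2‖ₑ ≤ pairBound α L M B u z := by
  rw [pairBound, enorm_smul, mul_assoc]
  gcongr
  by_cases h1 : z.1 ∈ B
  · refine (enorm_fracGradIntegrand_le h _ _).trans (le_mul_of_one_le_left zero_le ?_)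
    simp [h1]
  by_cases h2 : z.2 ∈ B
  · refine (enorm_fracGradIntegrand_le h _ _).trans (le_mul_of_one_le_left zero_le ?_)
    simp [h2]
  simp [fracGradIntegrand, hgB _ h1, hgB _ h2]

lemma aestronglyMeasurable_smul_fracGradIntegrand {u ψ : 𝔼 → ℝ}
    (hu : AEStronglyMeasurable u volume) (h : Continuous ψ) :
    AEStronglyMeasurable (fun z : 𝔼 × 𝔼 => u z.1 • fracGradIntegrand α ψ z.1 z.2)
      (volume.prod volume) :=
  hu.comp_fst.smul (measurable_fracGradIntegrand h).aestronglyMeasurable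

lemma integral_smul_fracGrad {u ψ : 𝔼 → ℝ}
    (h : Integrable (fun z : 𝔼 × 𝔼 => u z.1 • fracGradIntegrand α ψ z.1 z.2)
      (volume.prod volume)) :
    ∫ x, u x • fracGrad α ψ x
      = mu n α • ∫ z : 𝔼 × 𝔼, u z.1 • fracGradIntegrand α ψ z.1 z.2 ∂(volume.prod volume) := by
  rw [integral_prod _ h, ← integral_smul]
  congr with x : 1
  simp only [integral_smul, fracGrad]
  rw [smul_comm]

lemma integrable_smul_fracGrad {u ψ : 𝔼 → ℝ}
    (h : Integrable (fun z : 𝔼 × 𝔼 => u z.1 • fracGradIntegrand α ψ z.1 z.2)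
      (volume.prod volume)) :
    Integrable (fun x => u x • fracGrad α ψ x) := by
  refine (h.integral_prod_left.smul (mu n α)).congr (ae_of_all _ fun x => ?_)
  simp only [Pi.smul_apply, integral_smul, fracGrad]
  rw [smul_comm]

lemma integral_smul_fracGradNL {φ u ψ : 𝔼 → ℝ}
    (h : Integrable (fun z : 𝔼 × 𝔼 => φ z.1 • fracGradNLIntegrand α u ψ z.1 z.2)
      (volume.prod volume)) :
    ∫ x, φ x • fracGradNL α u ψ x
      = mu n α • ∫ z : 𝔼 × 𝔼, φ z.1 • fracGradNLIntegrand α u ψ z.1 z.2 ∂(volume.prod volume) := by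
  rw [integral_prod _ h, ← integral_smul]
  congr with x : 1
  simp only [integral_smul, fracGradNL]
  rw [smul_comm]

lemma integrable_smul_fracGradNL {φ u ψ : 𝔼 → ℝ}
    (h : Integrable (fun z : 𝔼 × 𝔼 => φ z.1 • fracGradNLIntegrand α u ψ z.1 z.2)
      (volume.prod volume)) :
    Integrable (fun x => φ x • fracGradNL α u ψ x) := by
  refine (h.integral_prod_left.smul (mu n α)).congr (ae_of_all _ fun x => ?_)
  simp only [Pi.smul_apply, integral_smul, fracGradNL]
  rw [smul_comm]

/-- For `u ∈ L^p` the identity defining the weak fractional gradient extends from smooth test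
functions to compactly supported Lipschitz functions. The limit along mollifications is taken by
dominated convergence on the product space, so that no convergence of `∇^α (G k)` itself is needed. -/
lemma IsWeakFracGrad.integral_smul_eq_of_isLipB (hn : 1 ≤ n) (hα0 : 0 < α) (hα1 : α < 1)
    (hp : 1 ≤ p) {u : 𝔼 → ℝ} (hu : MemLp u p volume) {v : 𝔼 → 𝔼} (hv : IsWeakFracGrad α u v)
    {g : 𝔼 → ℝ} (hg : IsLipB g) (hc : HasCompactSupport g) :
    ∫ x, g x • v x = -∫ x, u x • fracGrad α g x := by
  obtain ⟨L, M, h, hM⟩ := hg.exists_bounds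
  obtain ⟨R, G, hGs, hGi, hGM, hG0, hGt⟩ := exists_smooth_approx h hM hc
  set B := Metric.closedBall (0 : 𝔼) R with hB
  have hBm : MeasurableSet B := measurableSet_closedBall
  have hBfin : volume B ≠ ⊤ := measure_closedBall_lt_top.ne
  have hg0 : ∀ x, x ∉ B → g x = 0 := fun x hx =>
    tendsto_nhds_unique (hGt x) (by simp [hG0 _ x hx])
  have hD := lintegral_pairBound_lt_top hn hα0 hα1 hp hu hBm hBfin L M
  have hpi : ∀ f : 𝔼 → ℝ, IncrementBound f L M → (∀ x, x ∉ B → f x = 0) →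
      Integrable (fun z : 𝔼 × 𝔼 => u z.1 • fracGradIntegrand α f z.1 z.2) (volume.prod volume) :=
    fun f hf hf0 => integrable_of_enorm_le_pairBound hn hα0 hα1 hp hu hBm hBfin (C := 1)
      (aestronglyMeasurable_smul_fracGradIntegrand hu.1 hf.continuous)
      (by simpa using enorm_smul_fracGradIntegrand_le_pairBound hf hf0)
  have hGc : ∀ k, HasCompactSupport (G k) := fun k =>
    HasCompactSupport.intro (isCompact_closedBall 0 R) (hG0 k)
  have lhs : Tendsto (fun k => ∫ x, G k x • v x) atTop (𝓝 (∫ x, g x • v x)) := by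
    refine tendsto_integral_of_dominated_convergence (fun x => M * B.indicator (fun x => ‖v x‖) x)
      (fun k => (hGs k).continuous.aestronglyMeasurable.smul hv.2.1.aestronglyMeasurable) ?_
      (fun k => ae_of_all _ fun x => ?_) (ae_of_all _ fun x => (hGt x).smul_const _)
    · exact ((integrable_indicator_iff hBm).2
        (hv.2.1.integrableOn_isCompact (isCompact_closedBall 0 R)).norm).const_mul _
    · by_cases hx : x ∈ B
      · rw [norm_smul, Set.indicator_of_mem hx]
        gcongr
        exact hGM k x
      · simp [hG0 k x hx, hx]
  have rhs : Tendsto (fun k => ∫ x, u x • fracGrad α (G k) x) atTop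
      (𝓝 (∫ x, u x • fracGrad α g x)) := by
    rw [integral_smul_fracGrad (hpi g h hg0)]
    simp_rw [fun k => integral_smul_fracGrad (hpi (G k) (hGi k) (hG0 k))]
    refine Tendsto.const_smul ?_ _
    refine tendsto_integral_of_dominated_convergence (fun z => (pairBound α L M B u z).toReal)
      (fun k => (hpi (G k) (hGi k) (hG0 k)).1) ?_
      (fun k => ae_of_all _ fun z => ?_) (ae_of_all _ fun z => ?_)
    · exact integrable_toReal_of_lintegral_ne_top (aemeasurable_pairBound hu.1 hBm L M) hD.ne
    · rw [← toReal_enorm]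
      exact ENNReal.toReal_mono (pairBound_ne_top _ _ _ _ _)
        (enorm_smul_fracGradIntegrand_le_pairBound (hGi k) (hG0 k) z)
    · unfold fracGradIntegrand
      exact ((((hGt z.2).sub (hGt z.1)).div_const _).smul_const _).const_smul _
  refine tendsto_nhds_unique lhs ?_
  simp_rw [fun k => hv.2.2 (G k) (hGs k) (hGc k)]
  exact rhs.neg

/-! ### The weak Leibniz rule -/

/-- The nonlocal term is symmetric, `∫ u ∇^α_NL(φ, ψ) = ∫ φ ∇^α_NL(u, ψ)`, written as integrals over
the product space. -/
lemma integral_smul_nonlocal_symm {u φ ψ : 𝔼 → ℝ}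
    (h : Integrable (fun z : 𝔼 × 𝔼 => u z.1 • (φ z.2 - φ z.1) • fracGradIntegrand α ψ z.1 z.2)
      (volume.prod volume))
    (h1 : Integrable (fun z : 𝔼 × 𝔼 => (u z.1 * φ z.1) • fracGradIntegrand α ψ z.1 z.2)
      (volume.prod volume)) :
    Integrable (fun z : 𝔼 × 𝔼 => φ z.1 • fracGradNLIntegrand α u ψ z.1 z.2)
      (volume.prod volume) ∧
    ∫ z : 𝔼 × 𝔼, u z.1 • (φ z.2 - φ z.1) • fracGradIntegrand α ψ z.1 z.2 ∂(volume.prod volume)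
      = ∫ z : 𝔼 × 𝔼, φ z.1 • fracGradNLIntegrand α u ψ z.1 z.2 ∂(volume.prod volume) := by
  -- the off-diagonal part `u(x) φ(y) F(x, y)`, which the swap `x ↔ y` turns into `u(y) φ(x) F(x, y)`
  have h2 : Integrable (fun z : 𝔼 × 𝔼 => (u z.1 * φ z.2) • fracGradIntegrand α ψ z.1 z.2)
      (volume.prod volume) := by
    refine (h.add h1).congr (ae_of_all _ fun z => ?_)
    simp only [Pi.add_apply, smul_smul, ← add_smul]
    congr 1
    ring
  have h3 := h2.swap
  have e1 : ∀ z : 𝔼 × 𝔼, u z.1 • (φ z.2 - φ z.1) • fracGradIntegrand α ψ z.1 z.2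
      = (u z.1 * φ z.2) • fracGradIntegrand α ψ z.1 z.2
        - (u z.1 * φ z.1) • fracGradIntegrand α ψ z.1 z.2 := fun z => by
    rw [smul_smul, ← sub_smul, mul_sub]
  have e2 : ∀ z : 𝔼 × 𝔼, φ z.1 • fracGradNLIntegrand α u ψ z.1 z.2
      = (u z.swap.1 * φ z.swap.2) • fracGradIntegrand α ψ z.swap.1 z.swap.2
        - (u z.1 * φ z.1) • fracGradIntegrand α ψ z.1 z.2 := fun z => by
    rw [fracGradNLIntegrand_eq, smul_smul, Prod.fst_swap, Prod.snd_swap,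
      fracGradIntegrand_symm ψ z.2 z.1, ← sub_smul]
    congr 1
    ring
  simp_rw [e1, e2]
  refine ⟨h3.sub h1, ?_⟩
  rw [integral_sub h2 h1]
  refine Eq.trans ?_ (integral_sub h3 h1).symm
  congr 1
  exact (integral_prod_swap (fun z : 𝔼 × 𝔼 =>
    (u z.1 * φ z.2) • fracGradIntegrand α ψ z.1 z.2)).symm

lemma integral_add_add {X E : Type*} [MeasurableSpace X] [NormedAddCommGroup E] [NormedSpace ℝ E]
    {ν : Measure X} {f g h : X → E} (hf : Integrable f ν) (hg : Integrable g ν)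
    (hh : Integrable h ν) :
    ∫ x, f x + g x + h x ∂ν = ∫ x, f x ∂ν + ∫ x, g x ∂ν + ∫ x, h x ∂ν :=
  (integral_add (hf.add hg) hh).trans (congrArg (· + _) (integral_add hf hg))

/-- The weak form of the Leibniz rule: test the weak gradient of `u` with `φ ψ`, expand
`∇^α (φ ψ)` by the product rule, and move the nonlocal term from `φ` to `u` by symmetry. -/
lemma integral_smul_leibniz (hn : 1 ≤ n) (hα0 : 0 < α) (hα1 : α < 1)
    (hp : 1 ≤ p) {u : 𝔼 → ℝ} (hu : MemLp u p volume) {v : 𝔼 → 𝔼} (hv : IsWeakFracGrad α u v)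
    {ψ : 𝔼 → ℝ} (hψ : IsLipB ψ) {φ : 𝔼 → ℝ} (hφ : ContDiff ℝ ∞ φ) (hc : HasCompactSupport φ) :
    ∫ x, φ x • (ψ x • v x + u x • fracGrad α ψ x + fracGradNL α u ψ x)
      = -∫ x, (ψ x * u x) • fracGrad α φ x := by
  have hφL := isLipB_of_contDiff_of_hasCompactSupport hφ hc
  obtain ⟨L, M, hψi, hψM⟩ := hψ.exists_bounds
  obtain ⟨L', M', hφi, hφM⟩ := hφL.exists_bounds
  obtain ⟨L'', M'', hgi, -⟩ := (hφL.mul hψ).exists_bounds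
  set B := tsupport φ with hB
  have hBm : MeasurableSet B := (isClosed_tsupport φ).measurableSet
  have hBfin : volume B ≠ ⊤ := hc.isCompact.measure_lt_top.ne
  have hφ0 : ∀ x, x ∉ B → φ x = 0 := fun x hx => image_eq_zero_of_notMem_tsupport hx
  have hψm : Measurable ψ := hψi.continuous.measurable
  have hφm : Measurable φ := hφi.continuous.measurable
  -- the three terms of the product rule for the integrands
  have hi1 : Integrable (fun z : 𝔼 × 𝔼 => (ψ z.1 * u z.1) • fracGradIntegrand α φ z.1 z.2)
      (volume.prod volume) := by
    refine integrable_of_enorm_le_pairBound hn hα0 hα1 hp hu hBm hBfin (C := M) (L := L') (M := M')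
      (aestronglyMeasurable_smul_fracGradIntegrand (u := fun x => ψ x * u x)
        (hψm.aestronglyMeasurable.mul hu.1) hφi.continuous) fun z => ?_
    rw [mul_smul, enorm_smul]
    gcongr
    · rw [← ofReal_norm, ← ENNReal.ofReal_coe_nnreal]
      exact ENNReal.ofReal_le_ofReal (hψM _)
    · exact enorm_smul_fracGradIntegrand_le_pairBound hφi hφ0 z
  have hi2 : Integrable (fun z : 𝔼 × 𝔼 => (u z.1 * φ z.1) • fracGradIntegrand α ψ z.1 z.2)
      (volume.prod volume) := by
    refine integrable_of_enorm_le_pairBound hn hα0 hα1 hp hu hBm hBfin (C := M') (L := L) (M := M)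
      (aestronglyMeasurable_smul_fracGradIntegrand (u := fun x => u x * φ x)
        (hu.1.mul hφm.aestronglyMeasurable) hψi.continuous) fun z => ?_
    by_cases hz : z.1 ∈ B
    · rw [pairBound, enorm_smul, enorm_mul, mul_comm ‖u z.1‖ₑ, mul_assoc, mul_assoc]
      gcongr
      · rw [← ofReal_norm, ← ENNReal.ofReal_coe_nnreal]
        exact ENNReal.ofReal_le_ofReal (hφM _)
      · refine (enorm_fracGradIntegrand_le hψi _ _).trans (le_mul_of_one_le_left zero_le ?_)
        simp [hz]
    · simp [hφ0 _ hz]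
  have hig : Integrable (fun z : 𝔼 × 𝔼 =>
      u z.1 • fracGradIntegrand α (fun x => φ x * ψ x) z.1 z.2) (volume.prod volume) :=
    integrable_of_enorm_le_pairBound hn hα0 hα1 hp hu hBm hBfin (C := 1) (L := L'') (M := M'')
      (aestronglyMeasurable_smul_fracGradIntegrand hu.1 hgi.continuous)
      fun z => by
        rw [ENNReal.coe_one, one_mul]
        exact enorm_smul_fracGradIntegrand_le_pairBound hgi (fun x hx => by simp [hφ0 x hx]) z
  have hprod : ∀ z : 𝔼 × 𝔼, u z.1 • fracGradIntegrand α (fun x => φ x * ψ x) z.1 z.2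
      = (ψ z.1 * u z.1) • fracGradIntegrand α φ z.1 z.2
        + (u z.1 * φ z.1) • fracGradIntegrand α ψ z.1 z.2
        + u z.1 • (φ z.2 - φ z.1) • fracGradIntegrand α ψ z.1 z.2 := fun z => by
    rw [fracGradIntegrand_mul]
    simp only [smul_add, smul_smul, mul_comm (u z.1) (ψ z.1)]
  -- the nonlocal term is what remains of the product rule, hence integrable as well
  have hi3 : Integrable (fun z : 𝔼 × 𝔼 =>
      u z.1 • (φ z.2 - φ z.1) • fracGradIntegrand α ψ z.1 z.2) (volume.prod volume) := by
    refine ((hig.sub hi1).sub hi2).congr (ae_of_all _ fun z => ?_)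
    simp only [Pi.sub_apply, hprod z]
    abel
  obtain ⟨hi4, hsymm⟩ := integral_smul_nonlocal_symm hi3 hi2
  have hgv := hv.integral_smul_eq_of_isLipB hn hα0 hα1 hp hu (hφL.mul hψ) (hc.mul_right (f' := ψ))
  rw [integral_smul_fracGrad hig] at hgv
  simp_rw [hprod] at hgv
  rw [integral_add_add hi1 hi2 hi3, hsymm, smul_add, smul_add,
    ← integral_smul_fracGrad (u := fun x => ψ x * u x) hi1,
    ← integral_smul_fracGrad (u := fun x => u x * φ x) hi2, ← integral_smul_fracGradNL hi4] at hgv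
  have j1 : Integrable (fun x => (φ x * ψ x) • v x) :=
    hv.2.1.integrable_smul_left_of_hasCompactSupport (hφi.continuous.mul hψi.continuous)
      (hc.mul_right (f' := ψ))
  have j2 := integrable_smul_fracGrad (u := fun x => u x * φ x) hi2
  have j3 := integrable_smul_fracGradNL hi4
  have hsum : ∀ x, φ x • (ψ x • v x + u x • fracGrad α ψ x + fracGradNL α u ψ x)
      = (φ x * ψ x) • v x + (u x * φ x) • fracGrad α ψ x + φ x • fracGradNL α u ψ x := fun x => by
    simp only [smul_add, smul_smul, mul_comm (u x)]
  simp_rw [hsum]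
  rw [integral_add_add j1 j2 j3, hgv]
  abel

/-! ### Uniqueness, and the norms of the multiplier -/

/-- Weak fractional gradients are unique up to null sets. -/
lemma IsWeakFracGrad.ae_eq {u : 𝔼 → ℝ} {v w : 𝔼 → 𝔼} (hv : IsWeakFracGrad α u v)
    (hw : IsWeakFracGrad α u w) : v =ᵐ[volume] w := by
  have h := ae_eq_zero_of_integral_contDiff_smul_eq_zero (μ := (volume : Measure 𝔼))
    (hv.2.1.sub hw.2.1) fun φ hφ hc => by
      have h1 := hv.2.1.integrable_smul_left_of_hasCompactSupport hφ.continuous hc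
      have h2 := hw.2.1.integrable_smul_left_of_hasCompactSupport hφ.continuous hc
      simp only [Pi.sub_apply, smul_sub]
      rw [integral_sub h1 h2, hv.2.2 φ hφ hc, hw.2.2 φ hφ hc, sub_self]
  filter_upwards [h] with x hx
  exact sub_eq_zero.1 hx

/-- The infimum in `lipConst` is attained. -/
lemma lipschitzWith_lipConst {ψ : 𝔼 → ℝ} (h : IsLipB ψ) : LipschitzWith (lipConst ψ) ψ := by
  obtain ⟨K₀, hK₀⟩ := h.1
  refine LipschitzWith.of_dist_le_mul fun x y => ?_
  rcases eq_or_ne x y with rfl | hxy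
  · simp
  have hd : 0 < dist x y := dist_pos.2 hxy
  rw [← div_le_iff₀ hd]
  exact Real.toNNReal_le_iff_le_coe.1 <| le_csInf ⟨K₀, hK₀⟩ fun K hK =>
    Real.toNNReal_le_iff_le_coe.2 <| (div_le_iff₀ hd).2 (LipschitzWith.dist_le_mul hK x y)

/-- For continuous `ψ` the essential supremum bounds `|ψ|` at every point. -/
lemma abs_le_toNNReal_eLpNorm_top {ψ : 𝔼 → ℝ} (h : IsLipB ψ) :
    eLpNorm ψ ⊤ volume ≠ ⊤ ∧ ∀ x, |ψ x| ≤ (eLpNorm ψ ⊤ volume).toNNReal := by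
  obtain ⟨L, M, hi, hM⟩ := h.exists_bounds
  have hfin : eLpNorm ψ ⊤ volume ≠ ⊤ := by
    rw [eLpNorm_exponent_top]
    exact (eLpNormEssSup_lt_top_of_ae_bound (ae_of_all _ hM)).ne
  refine ⟨hfin, fun x => ?_⟩
  have hae : ∀ᵐ x ∂(volume : Measure 𝔼), |ψ x| ≤ (eLpNorm ψ ⊤ volume).toNNReal := by
    filter_upwards [enorm_ae_le_eLpNormEssSup ψ volume] with x hx
    rw [← eLpNorm_exponent_top, ← ENNReal.coe_toNNReal hfin] at hx
    exact_mod_cast hx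
  -- a closed set of full measure is everything
  have hcl : IsClosed {x | |ψ x| ≤ (eLpNorm ψ ⊤ volume).toNNReal} :=
    isClosed_le hi.continuous.abs continuous_const
  have hd := Measure.dense_of_ae hae
  have huniv := hcl.closure_eq.symm.trans hd.closure_eq
  exact huniv.ge (Set.mem_univ x)

lemma MemL1AddLinf.bdd_mul {u ψ : 𝔼 → ℝ} (hu : MemL1AddLinf u) (hψ : IsLipB ψ) :
    MemL1AddLinf (fun x => ψ x * u x) := by
  obtain ⟨f, g, hf, hg, hfg⟩ := hu
  obtain ⟨L, M, hi, hM⟩ := hψ.exists_bounds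
  refine ⟨fun x => ψ x * f x, fun x => ψ x * g x, ?_, ?_, ?_⟩
  · exact hf.of_le_mul (c := M) (hi.continuous.aestronglyMeasurable.mul hf.1)
      (ae_of_all _ fun x => by rw [norm_mul]; gcongr; exact hM x)
  · exact hg.of_le_mul (c := M) (hi.continuous.aestronglyMeasurable.mul hg.1)
      (ae_of_all _ fun x => by rw [norm_mul]; gcongr; exact hM x)
  · filter_upwards [hfg] with x hx
    rw [hx, mul_add]

end RieszFrac

open RieszFrac in
theorem lemma2p7 (n : ℕ) (hn : 1 ≤ n) (α : ℝ) (hα0 : 0 < α) (hα1 : α < 1) :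
    ∃ C : ℝ≥0, 0 < C ∧
      ∀ (p : ℝ≥0∞), 1 ≤ p →
      ∀ (ψ : EuclideanSpace ℝ (Fin n) → ℝ), RieszFrac.IsLipB ψ →
      ∀ (u : EuclideanSpace ℝ (Fin n) → ℝ), RieszFrac.MemFracSobolev α p u →
        -- the product lies in the fractional Sobolev space
        RieszFrac.MemFracSobolev α p (fun x => ψ x * u x) ∧
        -- the integrals in the Leibniz rule converge absolutely
        (∀ x, Integrable (RieszFrac.fracGradIntegrand α ψ x) volume) ∧
        (∀ᵐ x ∂(volume : Measure (EuclideanSpace ℝ (Fin n))),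
          Integrable (RieszFrac.fracGradNLIntegrand α u ψ x) volume) ∧
        -- `v` is the weak fractional gradient of `u`, and `w` that of `ψ u`
        ∀ v w : EuclideanSpace ℝ (Fin n) → EuclideanSpace ℝ (Fin n),
          RieszFrac.IsWeakFracGrad α u v →
          RieszFrac.IsWeakFracGrad α (fun x => ψ x * u x) w →
            (w =ᵐ[volume] fun x =>
              ψ x • v x + u x • RieszFrac.fracGrad α ψ x + RieszFrac.fracGradNL α u ψ x) ∧
            eLpNorm (fun x => w x - ψ x • v x) p volume ≤
              (C : ℝ≥0∞) * eLpNorm ψ ∞ volume ^ (1 - α) *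
                (RieszFrac.lipConst ψ : ℝ≥0∞) ^ α * eLpNorm u p volume := by
  set I := ∫⁻ h : EuclideanSpace ℝ (Fin n), incrKernel α 1 1 h with hI
  have hIfin : I ≠ ⊤ := (lintegral_incrKernel_one_one_lt_top hn hα0 hα1).ne
  -- the summand `1` only makes the constant positive
  refine ⟨3 * ‖mu n α‖₊ * I.toNNReal + 1, by positivity, fun p hp ψ hψ u ⟨hu, v₀, hv₀, hv₀p⟩ => ?_⟩
  obtain ⟨hψfin, hψM⟩ := abs_le_toNNReal_eLpNorm_top hψ
  set M := (eLpNorm ψ ⊤ volume).toNNReal with hM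
  have hψi : IncrementBound ψ (lipConst ψ) M := .of_lipschitzWith (lipschitzWith_lipConst hψ) hψM
  have hψm := hψi.continuous.aestronglyMeasurable (μ := volume)
  -- the commutator, which does not involve the weak gradient of `u`
  set r := fun x => u x • fracGrad α ψ x + fracGradNL α u ψ x with hr
  have hrm : AEStronglyMeasurable r volume :=
    (hu.1.smul (aestronglyMeasurable_fracGrad hψi.continuous)).add
      (aestronglyMeasurable_fracGradNL hu.1 hψi.continuous)
  have hrb : eLpNorm r p volume ≤ ((3 * ‖mu n α‖₊ * I.toNNReal + 1 : ℝ≥0) : ℝ≥0∞) *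
      eLpNorm ψ ⊤ volume ^ (1 - α) * (lipConst ψ : ℝ≥0∞) ^ α * eLpNorm u p volume := by
    refine (eLpNorm_smul_fracGrad_add_fracGradNL_le hp hu.1 hψi).trans ?_
    rw [lintegral_incrKernel hα0 hα1, hM, ENNReal.coe_toNNReal hψfin]
    push_cast
    rw [ENNReal.coe_toNNReal hIfin, ← hI, enorm_eq_nnnorm]
    calc _ = (3 * (‖mu n α‖₊ : ℝ≥0∞) * I) * eLpNorm ψ ⊤ volume ^ (1 - α)
          * (lipConst ψ : ℝ≥0∞) ^ α * eLpNorm u p volume := by ring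
      _ ≤ _ := by gcongr; exact le_self_add
  have hrp : MemLp r p volume := by
    refine ⟨hrm, hrb.trans_lt (ENNReal.mul_lt_top (ENNReal.mul_lt_top (ENNReal.mul_lt_top
      ENNReal.coe_lt_top ?_) ?_) hu.2)⟩
    · exact ENNReal.rpow_lt_top_of_nonneg (by linarith) hψfin
    · exact ENNReal.rpow_lt_top_of_nonneg hα0.le ENNReal.coe_ne_top
  have hψu : MemLp (fun x => ψ x * u x) p volume :=
    hu.of_le_mul (c := M) (hψm.mul hu.1)
      (ae_of_all _ fun x => by rw [norm_mul]; gcongr; exact hψM x)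
  have hψv : MemLp (fun x => ψ x • v₀ x) p volume :=
    hv₀p.of_le_mul (c := M) (hψm.smul hv₀p.1)
      (ae_of_all _ fun x => by rw [norm_smul]; gcongr; exact hψM x)
  have hw₀p : MemLp (fun x => ψ x • v₀ x + u x • fracGrad α ψ x + fracGradNL α u ψ x) p volume := by
    simpa only [hr, Pi.add_def, add_assoc] using hψv.add hrp
  have hw₀ : IsWeakFracGrad α (fun x => ψ x * u x)
      (fun x => ψ x • v₀ x + u x • fracGrad α ψ x + fracGradNL α u ψ x) :=
    ⟨hv₀.1.bdd_mul hψ, hw₀p.locallyIntegrable hp,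
      fun φ hφ hc => integral_smul_leibniz hn hα0 hα1 hp hu hv₀ hψ hφ hc⟩
  refine ⟨⟨hψu, _, hw₀, hw₀p⟩, integrable_fracGradIntegrand hn hα0 hα1 hψ,
    ae_integrable_fracGradNLIntegrand hn hα0 hα1 hp hu hψ, fun v w hv hw => ?_⟩
  have hwv : w =ᵐ[volume] fun x => ψ x • v x + u x • fracGrad α ψ x + fracGradNL α u ψ x := by
    filter_upwards [hv.ae_eq hv₀, hw.ae_eq hw₀] with x h1 h2
    rw [h2, h1]
  refine ⟨hwv, le_trans (le_of_eq (eLpNorm_congr_ae ?_)) hrb⟩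
  filter_upwards [hwv] with x hx
  simp only [hx, hr]
  abel
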